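/- Let $p$ be an odd prime, and for $b,c\in\mathbb Z$ let $D_p(b,c)$ denote the determinant $$D_p(b,c)=\det\left[(i^2+bij+cj^2)^{p-2}\right]_{1\le i,j\le p-1}\in\mathbb Z .$$ Let $\left(\frac{\cdot}{p}\right)$ be the Legendre symbol. If $p\equiv\pm2\pmod 5$, then $$\left(\frac{D_p(3,1)}{p}\right)=\begin{cases}\left(\frac{6}{p}\right)&\text{if }p\equiv1\pmod 4,\\[2pt] 0&\text{if }p\equiv3\pmod 4.\end{cases}$$ -/

import Mathlib

/-- The determinant `D_p(b,c) = |(i² + b i j + c j²)^(p-2)|` with `1 ≤ i, j ≤ p - 1`, an integer.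
The index `i : Fin (p - 1)` stands for the integer `i + 1`. -/
def sunDet (p : ℕ) (b c : ℤ) : ℤ :=
  Matrix.det (Matrix.of fun i j : Fin (p - 1) =>
    (((i : ℕ) + 1 : ℤ) ^ 2 + b * ((i : ℕ) + 1 : ℤ) * ((j : ℕ) + 1 : ℤ)
      + c * ((j : ℕ) + 1 : ℤ) ^ 2) ^ (p - 2))

/-! Modulo `p` the entries are the inverses of `i² + 3ij + j²`. By homogeneity this matrix sends the
vector `(j ^ k)` to `m_k • (i ^ (k - 2))`, with `m_k = quadMoment p k`, so up to a nonzero square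
the determinant is `m_1 ⋯ m_{p-1}`. As 5 is a nonresidue, `X² + 3X + 1` has a root `α` of norm 1
outside `𝔽_p`, and `5 m_k = -(α^k + α^(-k))` for `1 ≤ k ≤ p` (`five_mul_quadMoment`). Hence
`m_{p+1-k} = m_k`, and only `k = 1` and `k = (p+1)/2` stay unpaired. Here `α^((p+1)/2) =
(-1)^((p-1)/2)`. If `p ≡ 1 (mod 4)`, no moment vanishes and the unpaired ones give `(3/5)(-2/5)`,
which is 6 up to squares; if `p ≡ 3 (mod 4)`, then `m_{(p+1)/4} = 0`. -/

/-- The power moments `∑ u ^ k / (u ^ 2 + 3 u + 1)` over the nonzero residues `u` mod `p`. -/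
def quadMoment (p : ℕ) [Fact p.Prime] (k : ℕ) : ZMod p :=
  ∑ u : (ZMod p)ˣ, (u : ZMod p) ^ k * ((u : ZMod p) ^ 2 + 3 * u + 1)⁻¹

/-! ### Reduction mod `p` and diagonalisation -/

/-- The nonzero residues mod `p` are represented by `1, …, p - 1`. -/
theorem succ_cast_ne_zero {p : ℕ} [Fact p.Prime] (j : Fin (p - 1)) :
    ((j : ℕ) + 1 : ZMod p) ≠ 0 := by
  intro h
  have h' : (((j : ℕ) + 1 : ℕ) : ZMod p) = 0 := by push_cast; exact h
  rw [ZMod.natCast_eq_zero_iff] at h'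
  have := Nat.le_of_dvd (Nat.succ_pos _) h'
  omega

theorem succ_cast_injective {p : ℕ} [Fact p.Prime] :
    Function.Injective fun j : Fin (p - 1) => ((j : ℕ) + 1 : ZMod p) := by
  intro i j h
  have h' : ((i : ℕ) : ZMod p) = ((j : ℕ) : ZMod p) := add_right_cancel h
  rw [ZMod.natCast_eq_natCast_iff'] at h'
  rw [Nat.mod_eq_of_lt (by omega), Nat.mod_eq_of_lt (by omega)] at h'
  exact Fin.ext h'

theorem sum_succ_cast_eq_sum_units {p : ℕ} [Fact p.Prime] (f : ZMod p → ZMod p) :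
    ∑ j : Fin (p - 1), f ((j : ℕ) + 1) = ∑ u : (ZMod p)ˣ, f u := by
  refine Fintype.sum_bijective (fun j => Units.mk0 _ (succ_cast_ne_zero j)) ?_ _ _ (fun j => rfl)
  rw [Fintype.bijective_iff_injective_and_card]
  refine ⟨fun i j h => succ_cast_injective (congrArg Units.val h), ?_⟩
  rw [Fintype.card_fin, ZMod.card_units]

theorem pow_prime_sub_two_eq_inv {p : ℕ} [Fact p.Prime] (hp : p ≠ 2) (x : ZMod p) :
    x ^ (p - 2) = x⁻¹ := by
  have h2 := (Fact.out : p.Prime).two_le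
  rcases eq_or_ne x 0 with rfl | hx
  · rw [inv_zero, zero_pow (by omega)]
  · apply eq_inv_of_mul_eq_one_left
    rw [← pow_succ, show p - 2 + 1 = p - 1 by omega, ZMod.pow_card_sub_one_eq_one hx]

/-- Substitute `u ↦ x u` and use homogeneity of the form. -/
theorem sum_inv_quadForm_mul_pow {p : ℕ} [Fact p.Prime] {x : ZMod p} (hx : x ≠ 0) (k : ℕ) :
    x ^ 2 * ∑ u : (ZMod p)ˣ, (x ^ 2 + 3 * x * u + (u : ZMod p) ^ 2)⁻¹ * (u : ZMod p) ^ k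
      = x ^ k * quadMoment p k := by
  rw [quadMoment, ← Equiv.sum_comp (Equiv.mulLeft (Units.mk0 x hx)), Finset.mul_sum,
    Finset.mul_sum]
  refine Finset.sum_congr rfl fun u _ => ?_
  have h : x ^ 2 + 3 * x * (x * (u : ZMod p)) + (x * (u : ZMod p)) ^ 2
      = x ^ 2 * ((u : ZMod p) ^ 2 + 3 * u + 1) := by ring
  simp only [Equiv.coe_mulLeft, Units.val_mul, Units.val_mk0]
  rw [h, mul_inv, mul_pow, mul_assoc (x ^ 2)⁻¹, mul_inv_cancel_left₀ (pow_ne_zero 2 hx)]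
  ring

/-- The determinant is diagonalised by the power vectors `(j ^ k)`. -/
theorem sq_mul_sunDet_eq_prod_quadMoment {p : ℕ} [Fact p.Prime] (hp : p ≠ 2) :
    ∃ c : ZMod p, c ≠ 0 ∧
      c ^ 2 * (sunDet p 3 1 : ZMod p) = ∏ k ∈ Finset.range (p - 1), quadMoment p (k + 1) := by
  set x : Fin (p - 1) → ZMod p := fun j => (j : ℕ) + 1 with hxdef
  have hx : ∀ j, x j ≠ 0 := succ_cast_ne_zero
  set M : Matrix (Fin (p - 1)) (Fin (p - 1)) ℤ := Matrix.of fun i j : Fin (p - 1) =>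
    (((i : ℕ) + 1 : ℤ) ^ 2 + 3 * ((i : ℕ) + 1 : ℤ) * ((j : ℕ) + 1 : ℤ)
      + 1 * ((j : ℕ) + 1 : ℤ) ^ 2) ^ (p - 2) with hM
  set N : Matrix (Fin (p - 1)) (Fin (p - 1)) (ZMod p) :=
    Matrix.of fun i j => (x i ^ 2 + 3 * x i * x j + x j ^ 2)⁻¹ with hN
  have hdet : (sunDet p 3 1 : ZMod p) = N.det := by
    have : (Int.castRingHom (ZMod p)) M.det = N.det := by
      rw [RingHom.map_det]
      congr 1
      ext i j
      simp [hM, hN, hxdef, pow_prime_sub_two_eq_inv hp]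
    exact this
  -- The factor `x` shifts the exponents to `1, …, p - 1`, where the closed form of the moments
  -- holds; it fails at exponent 0.
  set W : Matrix (Fin (p - 1)) (Fin (p - 1)) (ZMod p) :=
    Matrix.diagonal x * Matrix.vandermonde x with hW
  have hWdet : W.det ≠ 0 := by
    rw [hW, Matrix.det_mul, Matrix.det_diagonal]
    exact mul_ne_zero (Finset.prod_ne_zero_iff.2 fun j _ => hx j)
      (Matrix.det_vandermonde_ne_zero_iff.2 succ_cast_injective)
  have hWapp : ∀ i k, W i k = x i ^ ((k : ℕ) + 1) := by
    intro i k
    rw [hW, Matrix.diagonal_mul, Matrix.vandermonde_apply, pow_succ']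
  clear_value W
  have key : Matrix.diagonal (fun i => x i ^ 2) * (N * W)
      = W * Matrix.diagonal (fun k : Fin (p - 1) => quadMoment p ((k : ℕ) + 1)) := by
    ext i k
    rw [Matrix.diagonal_mul, Matrix.mul_diagonal, Matrix.mul_apply, hWapp,
      ← sum_inv_quadForm_mul_pow (hx i), ← sum_succ_cast_eq_sum_units
        (fun u => (x i ^ 2 + 3 * x i * u + u ^ 2)⁻¹ * u ^ ((k : ℕ) + 1))]
    congr 1
    refine Finset.sum_congr rfl fun j _ => ?_
    rw [hWapp, hN, Matrix.of_apply]
  refine ⟨∏ i, x i, Finset.prod_ne_zero_iff.2 fun j _ => hx j, ?_⟩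
  have := congrArg Matrix.det key
  rw [Matrix.det_mul, Matrix.det_mul, Matrix.det_mul, Matrix.det_diagonal, Matrix.det_diagonal,
    Finset.prod_pow, mul_comm W.det, ← mul_assoc] at this
  rw [hdet, mul_right_cancel₀ hWdet this, Finset.prod_range (fun k => quadMoment p (k + 1))]

/-! ### The nonresidue 5 and the root `α` -/

theorem not_isSquare_five {p : ℕ} [Fact p.Prime] (hp_odd : p ≠ 2)
    (hp : (p : ℤ) ≡ 2 [ZMOD 5] ∨ (p : ℤ) ≡ -2 [ZMOD 5]) : ¬ IsSquare (5 : ZMod p) := by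
  have h2 : ∀ s : ZMod 5, 2 ≠ s * s := by decide
  have h3 : ∀ s : ZMod 5, -2 ≠ s * s := by decide
  have : Fact (Nat.Prime 5) := ⟨by norm_num⟩
  have h := ZMod.exists_sq_eq_prime_iff_of_mod_four_eq_one (p := 5) (q := p) (by norm_num) hp_odd
  have h5 : ((5 : ℕ) : ZMod p) = 5 := by norm_cast
  rw [h5] at h
  rw [← h]
  have : (p : ZMod 5) = 2 ∨ (p : ZMod 5) = -2 := by
    rcases hp with hp | hp
    · left; simpa using (ZMod.intCast_eq_intCast_iff _ _ 5).2 hp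
    · right; simpa using (ZMod.intCast_eq_intCast_iff _ _ 5).2 hp
  rintro ⟨s, hs⟩
  rcases this with h | h <;> rw [h] at hs
  · exact h2 s hs
  · exact h3 s hs

/-- The discriminant is 5. -/
theorem quadForm_ne_zero {p : ℕ} [Fact p.Prime] (h5 : ¬ IsSquare (5 : ZMod p)) (u : ZMod p) :
    u ^ 2 + 3 * u + 1 ≠ 0 := fun h =>
  h5 ⟨2 * u + 3, by linear_combination -4 * h⟩

/-- A root `φ` of `X ^ 2 - X - 1` has norm `-1` over `𝔽_p`, and `α = -φ ^ 2` is a root of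
`X ^ 2 + 3 X + 1`. -/
theorem exists_root_pow_half {p : ℕ} [Fact p.Prime] (hp_odd : p ≠ 2)
    (h5 : ¬ IsSquare (5 : ZMod p)) :
    ∃ α : AlgebraicClosure (ZMod p), α ^ 2 + 3 * α + 1 = 0 ∧
      α ^ ((p + 1) / 2) = (-1) ^ ((p + 1) / 2) * (-1) := by
  have hodd := (Fact.out : p.Prime).eq_two_or_odd'.resolve_left hp_odd
  obtain ⟨r, hr⟩ := IsAlgClosed.exists_pow_nat_eq (5 : AlgebraicClosure (ZMod p)) two_pos
  have h2 : (2 : AlgebraicClosure (ZMod p)) ≠ 0 := by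
    have := (CharP.cast_eq_zero_iff (AlgebraicClosure (ZMod p)) p 2).not.2 fun h =>
      hp_odd ((Nat.prime_dvd_prime_iff_eq Fact.out Nat.prime_two).1 h)
    exact_mod_cast this
  have hrp : r ^ p = -r := by
    have h50 : (5 : ZMod p) ≠ 0 := fun h => h5 (h ▸ IsSquare.zero)
    have h := (ZMod.pow_div_two_eq_neg_one_or_one p h50).resolve_left
      fun h => h5 ((ZMod.euler_criterion p h50).2 h)
    have h' := congrArg (algebraMap (ZMod p) (AlgebraicClosure (ZMod p))) h
    rw [map_pow, map_ofNat, map_neg, map_one, ← hr, ← pow_mul] at h'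
    have hp : p = 2 * (p / 2) + 1 := by obtain ⟨k, rfl⟩ := hodd; omega
    calc r ^ p = r ^ (2 * (p / 2) + 1) := congrArg (r ^ ·) hp
      _ = -r := by rw [pow_succ, h', neg_one_mul]
  set φ := (1 + r) / 2 with hφ
  have hφ2 : φ ^ 2 = φ + 1 := by
    rw [hφ]; field_simp; linear_combination hr
  have hφp : φ ^ p = 1 - φ := by
    have h2p : (2 : AlgebraicClosure (ZMod p)) ^ p = 2 := by
      have := congrArg (algebraMap (ZMod p) (AlgebraicClosure (ZMod p))) (ZMod.pow_card (2 : ZMod p))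
      rwa [map_pow, map_ofNat] at this
    rw [hφ, div_pow, add_pow_char, one_pow, hrp, h2p]
    field_simp; ring
  have hnorm : φ ^ (p + 1) = -1 := by
    rw [pow_succ, hφp]; linear_combination -hφ2
  refine ⟨-φ ^ 2, ?_, ?_⟩
  · linear_combination (φ ^ 2 + φ - 1) * hφ2
  · rw [neg_pow, ← pow_mul, Nat.mul_div_cancel' (by obtain ⟨k, rfl⟩ := hodd; omega), hnorm]

/-! ### Evaluation of the moments -/

/-- The quadratic cancels the denominator, leaving the power sum of `u ^ k`. -/
theorem quadMoment_recurrence {p : ℕ} [Fact p.Prime] (h5 : ¬ IsSquare (5 : ZMod p)) (k : ℕ) :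
    quadMoment p (k + 2) + 3 * quadMoment p (k + 1) + quadMoment p k
      = if p - 1 ∣ k then -1 else 0 := by
  have h := FiniteField.sum_pow_units (ZMod p) k
  rw [ZMod.card] at h
  rw [← h]
  simp only [quadMoment]
  rw [Finset.mul_sum, ← Finset.sum_add_distrib, ← Finset.sum_add_distrib]
  refine Finset.sum_congr rfl fun u _ => ?_
  have := mul_inv_cancel₀ (quadForm_ne_zero h5 (u : ZMod p))
  linear_combination (u : ZMod p) ^ k * this

theorem quadMoment_two {p : ℕ} [Fact p.Prime] : quadMoment p 2 = quadMoment p 0 := by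
  simp only [quadMoment]
  rw [← Equiv.sum_comp (Equiv.inv (ZMod p)ˣ)]
  refine Finset.sum_congr rfl fun u _ => ?_
  have hu : (u : ZMod p) ≠ 0 := u.ne_zero
  have : ((u : ZMod p)⁻¹ ^ 2 + 3 * (u : ZMod p)⁻¹ + 1)
      = (u : ZMod p)⁻¹ ^ 2 * ((u : ZMod p) ^ 2 + 3 * u + 1) := by field_simp; ring
  simp only [Equiv.inv_apply, Units.val_inv_eq_inv_val]
  rw [this, mul_inv, ← mul_assoc, mul_inv_cancel₀ (pow_ne_zero 2 (inv_ne_zero hu)), pow_zero]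

theorem quadMoment_add_card_sub_one {p : ℕ} [Fact p.Prime] (k : ℕ) :
    quadMoment p (k + (p - 1)) = quadMoment p k := by
  simp only [quadMoment]
  refine Finset.sum_congr rfl fun u _ => ?_
  rw [pow_add, ZMod.pow_card_sub_one_eq_one u.ne_zero, mul_one]

/-- The moments are given by the Lucas-type sequence `α ^ k + α ^ (-k)`. -/
theorem five_mul_quadMoment {p : ℕ} [Fact p.Prime] (hp_odd : p ≠ 2)
    (h5 : ¬ IsSquare (5 : ZMod p)) {K : Type*} [Field K] [Algebra (ZMod p) K] {α : K}
    (hα : α ^ 2 + 3 * α + 1 = 0) (hαp : α ^ (p + 1) = 1) {k : ℕ} (hk : 1 ≤ k) (hkp : k ≤ p) :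
    5 * algebraMap (ZMod p) K (quadMoment p k) = -(α ^ k + α⁻¹ ^ k) := by
  have hp3 : 3 ≤ p := by have := (Fact.out : p.Prime).two_le; omega
  have hα0 : α ≠ 0 := by rintro rfl; simp at hα
  obtain ⟨β, hβ⟩ : ∃ β, β = α⁻¹ := ⟨_, rfl⟩
  have hαβ : α * β = 1 := by rw [hβ, mul_inv_cancel₀ hα0]
  have hsum : α + β = -3 := by
    apply mul_left_cancel₀ hα0
    linear_combination hα + hαβ
  have hβ2 : β ^ 2 + 3 * β + 1 = 0 := by linear_combination β * hsum - hαβ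
  have h5K : (5 : K) ≠ 0 := by
    intro h
    apply h5
    have : (5 : ZMod p) = 0 := (algebraMap (ZMod p) K).injective (by rw [map_ofNat, h, map_zero])
    rw [this]; exact ⟨0, by simp⟩
  have h2K : (2 : K) ≠ 0 := by
    intro h
    have h2 : (2 : ZMod p) = 0 := (algebraMap (ZMod p) K).injective (by rw [map_ofNat, h, map_zero])
    exact h5 ⟨1, by linear_combination 2 * h2⟩
  rw [← hβ]
  -- The defect of the closed form. It obeys the homogeneous recurrence for `1 ≤ k < p - 1`, so it
  -- vanishes once `d 1 = d 2 = 0`. Two relations force this: `hrel` from `k = 0`, and `h73` from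
  -- going once round the period. Their determinant is ±5.
  set d : ℕ → K := fun k => 5 * algebraMap (ZMod p) K (quadMoment p k) + (α ^ k + β ^ k) with hd
  have hrec : ∀ k, 1 ≤ k → k < p - 1 → d (k + 2) + 3 * d (k + 1) + d k = 0 := by
    intro k hk hkp
    have h := quadMoment_recurrence h5 k
    rw [if_neg (Nat.not_dvd_of_pos_of_lt hk hkp)] at h
    have h' := congrArg (algebraMap (ZMod p) K) h
    simp only [map_add, map_mul, map_ofNat, map_zero] at h'
    simp only [hd]
    linear_combination 5 * h' + α ^ k * hα + β ^ k * hβ2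
  have hrel : 2 * d 2 + 3 * d 1 = 0 := by
    have h := quadMoment_recurrence h5 0
    rw [if_pos (dvd_zero _), ← quadMoment_two] at h
    have h' := congrArg (algebraMap (ZMod p) K) h
    simp only [map_add, map_mul, map_ofNat, map_neg, map_one, zero_add] at h'
    simp only [hd]
    linear_combination 5 * h' + 2 * hα + 2 * hβ2 - 3 * hsum
  have hβp : β ^ (p + 1) = 1 := by rw [hβ, inv_pow, hαp, inv_one]
  have hpred : ∀ x y : K, x * y = 1 → x ^ (p + 1) = 1 → x ^ (p - 1) = y ^ 2 := by
    intro x y hxy hx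
    have : x ^ (p + 1) = x ^ (p - 1) * x ^ 2 := by rw [← pow_add]; congr 1; omega
    rw [hx] at this
    linear_combination -y ^ 2 * this - x ^ (p - 1) * (x * y + 1) * hxy
  have hβα : β * α = 1 := by rw [mul_comm, hαβ]
  have hdpred : d (p - 1) = d 2 := by
    have h := quadMoment_add_card_sub_one (p := p) 0
    rw [zero_add, ← quadMoment_two] at h
    simp only [hd]
    rw [h, hpred α β hαβ hαp, hpred β α hβα hβp]
    ring
  have hdp : d p = d 1 := by
    have h := quadMoment_add_card_sub_one (p := p) 1
    rw [show 1 + (p - 1) = p by omega] at h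
    have h1 := hpred α β hαβ hαp
    have h2 := hpred β α hβα hβp
    have hpow : ∀ x : K, x ^ p = x ^ (p - 1) * x := fun x => by
      rw [← pow_succ, Nat.sub_add_cancel (by omega)]
    simp only [hd]
    rw [h, hpow, hpow, h1, h2]
    linear_combination (α + β) * hαβ
  have hgeom : ∀ m, m + 2 ≤ p → d (m + 2) - β * d (m + 1) = α ^ m * (d 2 - β * d 1) := by
    intro m
    induction m with
    | zero => intro _; simp
    | succ m ih =>
      intro hm
      have h := hrec (m + 1) (by omega) (by omega)
      rw [pow_succ]
      linear_combination h + α * ih (by omega) - d (m + 2) * hsum + d (m + 1) * hαβ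
  have hlast := hgeom (p - 2) (by omega)
  rw [show p - 2 + 2 = p by omega, show p - 2 + 1 = p - 1 by omega, hdp, hdpred] at hlast
  have hpow : α ^ (p - 2) = β ^ 3 := by
    have h1 := hpred α β hαβ hαp
    rw [show p - 1 = p - 2 + 1 by omega, pow_succ] at h1
    linear_combination β * h1 - α ^ (p - 2) * hαβ
  rw [hpow] at hlast
  have h73 : 7 * d 1 = -3 * d 2 := by
    have e1 : α ^ 2 * (d 1 - β * d 2) = β * (d 2 - β * d 1) := by
      rw [hlast]; linear_combination (β * (d 2 - β * d 1)) * (α * β + 1) * hαβ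
    linear_combination e1 + (α * d 2 + 2 * d 1) * hαβ + (d 2 - (α + β - 3) * d 1) * hsum
  have hd1 : d 1 = 0 := by
    apply (mul_eq_zero.1 (?_ : 5 * d 1 = 0)).resolve_left h5K
    linear_combination 2 * h73 - 3 * hrel
  have hd2 : d 2 = 0 := by
    apply (mul_eq_zero.1 (?_ : 2 * d 2 = 0)).resolve_left h2K
    rw [hd1] at hrel; simpa using hrel
  have hall : ∀ m, m + 1 ≤ p → d (m + 1) = 0 := by
    intro m
    induction m with
    | zero => intro _; exact hd1
    | succ m ih =>
      intro hm
      have := hgeom m (by omega)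
      rw [ih (by omega), hd1, hd2] at this
      simpa using this
  have := hall (k - 1) (by omega)
  rw [show k - 1 + 1 = k by omega] at this
  exact eq_neg_of_add_eq_zero_left this

/-! ### Pairing of the factors and conclusion -/

/-- The reflection `i ↦ 2n + 2 - i` fixes `n + 1` and sends 0 out of the range. -/
theorem prod_range_eq_mul_sq {R : Type*} [CommMonoid R] (f : ℕ → R) (n : ℕ)
    (hf : ∀ i, 1 ≤ i → i ≤ n → f (2 * n + 2 - i) = f i) :
    ∏ i ∈ Finset.range (2 * n + 2), f i = f 0 * f (n + 1) * (∏ i ∈ Finset.range n, f (i + 1)) ^ 2 := by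
  rw [Finset.prod_range_succ', show 2 * n + 1 = n + 1 + n by omega, Finset.prod_range_add,
    Finset.prod_range_succ]
  have : ∏ x ∈ Finset.range n, f (n + 1 + x + 1) = ∏ i ∈ Finset.range n, f (i + 1) := by
    rw [← Finset.prod_range_reflect]
    refine Finset.prod_congr rfl fun i hi => ?_
    rw [Finset.mem_range] at hi
    rw [← hf (i + 1) (by omega) (by omega)]
    congr 1; omega
  rw [this, sq, mul_comm _ (f 0)]
  simp only [mul_assoc, mul_left_comm, mul_comm]


theorem quadMoment_symm {p : ℕ} [Fact p.Prime] (hp_odd : p ≠ 2)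
    (h5 : ¬ IsSquare (5 : ZMod p)) {K : Type*} [Field K] [Algebra (ZMod p) K] {α : K}
    (hα : α ^ 2 + 3 * α + 1 = 0) (hαp : α ^ (p + 1) = 1) {k : ℕ} (hk : 1 ≤ k) (hkp : k ≤ p) :
    quadMoment p (p + 1 - k) = quadMoment p k := by
  have h5K : (5 : K) ≠ 0 := fun h => h5 <| by
    rw [(algebraMap (ZMod p) K).injective (by rw [map_ofNat, h, map_zero] :
      algebraMap (ZMod p) K 5 = algebraMap (ZMod p) K 0)]
    exact IsSquare.zero
  have hα0 : α ≠ 0 := by rintro rfl; simp at hα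
  have hinv : α ^ (p + 1 - k) = α⁻¹ ^ k := by
    rw [pow_sub₀ _ hα0 (by omega), hαp, one_mul, inv_pow]
  have hinv' : α⁻¹ ^ (p + 1 - k) = α ^ k := by
    rw [inv_pow, hinv, inv_pow, inv_inv]
  apply (algebraMap (ZMod p) K).injective
  apply mul_left_cancel₀ h5K
  rw [five_mul_quadMoment hp_odd h5 hα hαp hk hkp,
    five_mul_quadMoment hp_odd h5 hα hαp (by omega) (by omega), hinv, hinv', add_comm]

theorem mainTheorem6 (p : ℕ) [Fact p.Prime] (hp_odd : p ≠ 2)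
    (hp : (p : ℤ) ≡ 2 [ZMOD 5] ∨ (p : ℤ) ≡ -2 [ZMOD 5]) :
    (p ≡ 1 [MOD 4] → legendreSym p (sunDet p 3 1) = legendreSym p 6) ∧
    (p ≡ 3 [MOD 4] → legendreSym p (sunDet p 3 1) = 0) := by
  have h5 := not_isSquare_five hp_odd hp
  have h50 : (5 : ZMod p) ≠ 0 := fun h => h5 (h ▸ IsSquare.zero)
  have hp2 := (Fact.out : p.Prime).two_le
  obtain ⟨α, hα, hhalf⟩ := exists_root_pow_half hp_odd h5
  have hα0 : α ≠ 0 := by rintro rfl; simp at hα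
  have hodd := (Fact.out : p.Prime).eq_two_or_odd'.resolve_left hp_odd
  have hαp : α ^ (p + 1) = 1 := by
    have h2 : p + 1 = (p + 1) / 2 * 2 := by obtain ⟨k, rfl⟩ := hodd; omega
    rw [h2, pow_mul, hhalf, mul_pow, ← pow_mul, mul_comm _ 2, pow_mul, neg_one_sq, one_pow, one_mul]
  have hval := fun (k : ℕ) (h1 : 1 ≤ k) (h2 : k ≤ p) =>
    five_mul_quadMoment hp_odd h5 hα hαp h1 h2
  have hzero : ∀ k, 1 ≤ k → k ≤ p → (quadMoment p k = 0 ↔ α ^ (2 * k) = -1) := by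
    intro k h1 h2
    have h : α ^ k * algebraMap (ZMod p) _ (5 * quadMoment p k) = -(α ^ (2 * k) + 1) := by
      rw [map_mul, map_ofNat, hval k h1 h2, mul_neg, mul_add, inv_pow,
        mul_inv_cancel₀ (pow_ne_zero k hα0), two_mul, pow_add]
    rw [eq_neg_iff_add_eq_zero, ← neg_eq_zero (a := α ^ (2 * k) + 1), ← h, mul_eq_zero,
      or_iff_right (pow_ne_zero _ hα0), map_eq_zero, mul_eq_zero, or_iff_right h50]
  obtain ⟨c, hc, hdet⟩ := sq_mul_sunDet_eq_prod_quadMoment hp_odd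
  constructor
  · intro h4
    obtain ⟨n, hn⟩ : ∃ n, p = 4 * n + 5 := ⟨(p - 5) / 4, by
      have : p ≠ 1 := (Fact.out : p.Prime).one_lt.ne'
      unfold Nat.ModEq at h4; omega⟩
    have hhalfodd : Odd ((p + 1) / 2) := ⟨n + 1, by omega⟩
    have hhalf1 : α ^ ((p + 1) / 2) = 1 := by
      rw [hhalf, hhalfodd.neg_one_pow, neg_one_mul, neg_neg]
    have h2 : (2 : ZMod p) ≠ 0 := fun h =>
      h5 ⟨1, by linear_combination 2 * h⟩
    -- Raising `α ^ (2k) = -1` to the odd power `(p+1)/2` would give `1 = -1`.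
    have hne : ∀ k, 1 ≤ k → k ≤ p → quadMoment p k ≠ 0 := by
      intro k hk1 hk2 h
      rw [hzero k hk1 hk2] at h
      have h' := congrArg (· ^ ((p + 1) / 2)) h
      simp only [hhalfodd.neg_one_pow] at h'
      rw [← pow_mul, mul_comm, pow_mul, hhalf1, one_pow] at h'
      apply h2
      apply (algebraMap (ZMod p) (AlgebraicClosure (ZMod p))).injective
      rw [map_ofNat, map_zero]
      linear_combination h'
    have hone : 5 * quadMoment p 1 = 3 := by
      apply (algebraMap (ZMod p) (AlgebraicClosure (ZMod p))).injective
      rw [map_mul, map_ofNat, map_ofNat, hval 1 le_rfl (by omega)]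
      field_simp
      linear_combination -hα
    have hmid : 5 * quadMoment p (2 * n + 3) = -2 := by
      apply (algebraMap (ZMod p) (AlgebraicClosure (ZMod p))).injective
      rw [map_mul, map_ofNat, map_neg, map_ofNat, hval (2 * n + 3) (by omega) (by omega), inv_pow,
        show 2 * n + 3 = (p + 1) / 2 by omega, hhalf1]
      norm_num
    have hprod := prod_range_eq_mul_sq (fun k => quadMoment p (k + 1)) (2 * n + 1) fun i h1 h2 => by
      have := quadMoment_symm hp_odd h5 hα hαp (k := i + 1) (by omega) (by omega)
      rw [← this]
      congr 1; omega
    rw [show 2 * (2 * n + 1) + 2 = p - 1 by omega, ← hdet] at hprod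
    set q := ∏ i ∈ Finset.range (2 * n + 1), quadMoment p (i + 1 + 1) with hq
    have hq0 : q ≠ 0 := Finset.prod_ne_zero_iff.2 fun i hi => by
      rw [Finset.mem_range] at hi
      exact hne _ (by omega) (by omega)
    -- A square root of `-1` absorbs the sign of `3 · (-2)`.
    obtain ⟨i, hi⟩ := ZMod.exists_sq_eq_neg_one_iff.2 (show p % 4 ≠ 3 by omega)
    have hi0 : i ≠ 0 := by rintro rfl; simp at hi
    have hfin : (sunDet p 3 1 : ZMod p) * (5 * c) ^ 2 = 6 * (i * q) ^ 2 := by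
      simp only [zero_add, show 2 * n + 1 + 1 + 1 = 2 * n + 3 by omega] at hprod
      linear_combination 25 * hprod + 5 * quadMoment p (2 * n + 3) * q ^ 2 * hone
        + 3 * q ^ 2 * hmid + 6 * q ^ 2 * hi
    have h := congrArg (quadraticChar (ZMod p)) hfin
    rw [map_mul, map_mul, quadraticChar_sq_one' (mul_ne_zero h50 hc),
      quadraticChar_sq_one' (mul_ne_zero hi0 hq0), mul_one, mul_one] at h
    rw [legendreSym, legendreSym, h]
    norm_num
  · intro h4
    obtain ⟨n, hn⟩ : ∃ n, p = 4 * n + 3 := ⟨p / 4, by unfold Nat.ModEq at h4; omega⟩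
    have hev : Even ((p + 1) / 2) := ⟨n + 1, by omega⟩
    have hz : quadMoment p (n + 1) = 0 := by
      rw [hzero _ (by omega) (by omega), show 2 * (n + 1) = (p + 1) / 2 by omega, hhalf,
        hev.neg_one_pow, one_mul]
    rw [Finset.prod_eq_zero (Finset.mem_range.2 (by omega : n < p - 1)) hz] at hdet
    rw [legendreSym.eq_zero_iff]
    exact (mul_eq_zero.1 hdet).resolve_left (pow_ne_zero 2 hc)
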